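/- Let $\Sigma$ be a finite alphabet. A (finite, complete, deterministic) semiautomaton with input alphabet $\Sigma$ consists of a finite set $Q$ of states and a transition function $\delta\colon Q\times\Sigma\to Q$; words act on $Q$ letter by letter from left to right, and $Qw=\{qw : q\in Q\}$. For $k\ge 1$, a word $w\in\Sigma^+$ is $k$-compressing for the semiautomaton if $|Q|-|Qw|\ge k$; the semiautomaton is $k$-compressible if it has a $k$-compressing word; and $w\in\Sigma^+$ is $k$-collapsing if it is $k$-compressing for every $k$-compressible semiautomaton with input alphabet $\Sigma$. A word is $k$-full if every word of length $k$ over $\Sigma$ is a factor (contiguous subword) of it. Let $c(k,t)$ be the length of a shortest $k$-collapsing word over an alphabet of $t$ letters. The dual of a word over $\{a,b\}$ is obtained by interchanging $a$ and $b$, and the dual of a language is the set of duals of its words. Let $$W=\{ab^2ab^2a,\ ab^2a^2b^2a,\ abab^2aba,\ ab^3aba,\ abab^3a,\ ab^3ab^3a,\ ba^2baba^2b,\ a^2b^3a,\ ba^2ba^2b,$$ $$ba^2b^2a^2b,\ baba^2bab,\ ba^3bab,\ baba^3b,\ ba^3ba^3b,\ ab^2abab^2a,\ b^2a^3b,\ a^2b^3a^2,\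 b^2a^3b^2\},$$ let $W'=W\setminus\{a^2b^3a^2,\,b^2a^3b^2\}$, let $\mathcal L=b(a^+b)^*(ba)^+a(ba)^*ab(b+ab^2)$ (a regular language, $+$ in the last bracket denoting union), and let $$w_3=b^2a^3b\cdot a^3b^3aba^2\cdot baba^2ba^2b^2a^2b^2ab^2aba\cdot b^2aba^3bab^3\cdot ab^3a .$$ Then: 1. Every $3$-full word over $\{a,b\}$ that has all words of $W$ as factors is $3$-collapsing. 2. For all $u\in\mathcal L$ and all $v$ in the dual of $\mathcal L$, every $3$-full word over $\{a,b\}$ that has $u$, $v$ and all words of $W'$ as factors is $3$-collapsing. 3. The word $w_3$ has length $53$, is $3$-full, has as factors all words of $W'$ as well as $u=b^2aba^3bab^2\in\mathcal L$ and $v=a^2b^3aba^2$, which lies in the dual of $\mathcal L$; and $w_3$ is $3$-collapsing. 4. Consequently $c(3,2)\le 53$. -/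

import Mathlib

/-!
The deficiency of a word `w` is the number of states missing from `Qw`, and it is at most two on
every factor of a word that is not 3-compressing. So it suffices to bound all deficiencies by two
in every automaton in which they are at most two on the words of length three, on `W'`, and on one
word each of `𝓛` and its dual.

If `S` is missing after `w`, then the states all of whose preimages under `x` lie in `S` are
missing after `wx`. A letter `x` with `xx` of deficiency at most two has one of five shapes,
according to the states it misses and those it identifies. For each pair of shapes and each way of
overlapping the states involved, a finite search over partially known transition tables reads the
test words symbolically. It branches on an unknown transition when it needs one, discards a branch
once a test word is known to miss three states, and succeeds on a branch if closing the possible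
missing sets under both letters never exceeds two states. The word of `𝓛` is not known; following
the possible missing sets through the regular expression discards a branch in which every word of
`𝓛` misses three states. Interchanging `a` and `b` leaves one order of each pair of shapes to
search.
-/

namespace CollapsingWords

open Computability

/-- A complete deterministic semiautomaton with state set `Q` and input alphabet `α` is given by its
transition function `δ : Q → α → Q`; this is the action of words on states, letters being read from
left to right: `q (x₁ x₂ … xₙ) = (… ((q x₁) x₂) …) xₙ`. -/
def act {Q α : Type} (δ : Q → α → Q) (w : List α) (q : Q) : Q :=
  w.foldl δ q

/-- The deficiency `|Q| - |Qw|` (the subtraction never truncates when `Q` is finite). -/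
noncomputable def deficiency {Q α : Type} (δ : Q → α → Q) (w : List α) : ℕ :=
  Nat.card Q - (Set.range (act δ w)).ncard

/-- `w ∈ Σ⁺` is `k`-compressing for the automaton `δ`. -/
def IsCompressing {Q α : Type} (k : ℕ) (δ : Q → α → Q) (w : List α) : Prop :=
  w ≠ [] ∧ k ≤ deficiency δ w

/-- The automaton `δ` is `k`-compressible. -/
def IsCompressible {Q α : Type} (k : ℕ) (δ : Q → α → Q) : Prop :=
  ∃ w : List α, IsCompressing k δ w

/-- `w ∈ Σ⁺` is `k`-collapsing: it is `k`-compressing for every `k`-compressible finite automaton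
with input alphabet `α`. -/
def IsCollapsing {α : Type} (k : ℕ) (w : List α) : Prop :=
  w ≠ [] ∧ ∀ (Q : Type) [Finite Q] (δ : Q → α → Q), IsCompressible k δ → IsCompressing k δ w

/-- `w` is `k`-full: every word of length `k` is a factor of `w`. -/
def IsFull {α : Type} (k : ℕ) (w : List α) : Prop :=
  ∀ x : List α, x.length = k → x <:+: w

/-- `c(k,t)`: the length of a shortest `k`-collapsing word over an alphabet of `t` letters
(`⊤` if there were no such word). -/
noncomputable def c (k t : ℕ) : ℕ∞ :=
  ⨅ w ∈ {w : List (Fin t) | IsCollapsing k w}, (w.length : ℕ∞)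

/-- The two letters of the binary alphabet. -/
abbrev a : Fin 2 := 0

/-- The two letters of the binary alphabet. -/
abbrev b : Fin 2 := 1

/-- The dual of a word: `a` and `b` are interchanged. -/
def dual (w : List (Fin 2)) : List (Fin 2) :=
  w.map (Equiv.swap a b)

/-- The set `W` of eighteen words. -/
def W : Finset (List (Fin 2)) :=
  {[a, b, b, a, b, b, a],
   [a, b, b, a, a, b, b, a],
   [a, b, a, b, b, a, b, a],
   [a, b, b, b, a, b, a],
   [a, b, a, b, b, b, a],
   [a, b, b, b, a, b, b, b, a],
   [b, a, a, b, a, b, a, a, b],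
   [a, a, b, b, b, a],
   [b, a, a, b, a, a, b],
   [b, a, a, b, b, a, a, b],
   [b, a, b, a, a, b, a, b],
   [b, a, a, a, b, a, b],
   [b, a, b, a, a, a, b],
   [b, a, a, a, b, a, a, a, b],
   [a, b, b, a, b, a, b, b, a],
   [b, b, a, a, a, b],
   [a, a, b, b, b, a, a],
   [b, b, a, a, a, b, b]}

/-- `W` without `a²b³a²` and `b²a³b²`. -/
def W' : Finset (List (Fin 2)) :=
  W \ {[a, a, b, b, b, a, a], [b, b, a, a, a, b, b]}

/-- The regular language `𝓛 = b (a⁺b)* (ba)⁺ a (ba)* ab (b + ab²)`. -/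
def L : Language (Fin 2) :=
  {[b]} * ({[a]} * {[a]}∗ * {[b]})∗ * ({[b, a]} * {[b, a]}∗) * {[a]} * {[b, a]}∗ * {[a, b]} *
    ({[b]} + {[a, b, b]})

/-- The dual language of `𝓛`. -/
def dualL : Language (Fin 2) :=
  {w | dual w ∈ L}

/-- `u = b²aba³bab²`. -/
def u : List (Fin 2) :=
  [b, b, a, b, a, a, a, b, a, b, b]

/-- `v = a²b³aba²`. -/
def v : List (Fin 2) :=
  [a, a, b, b, b, a, b, a, a]

/-- `w₃ = b²a³b · a³b³aba² · baba²ba²b²a²b²ab²aba · b²aba³bab³ · ab³a`. -/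
def w₃ : List (Fin 2) :=
  [b, b, a, a, a, b] ++
  [a, a, a, b, b, b, a, b, a, a] ++
  [b, a, b, a, a, b, a, a, b, b, a, a, b, b, a, b, b, a, b, a] ++
  [b, b, a, b, a, a, a, b, a, b, b, b] ++
  [a, b, b, b, a]

end CollapsingWords

namespace CollapsingWords

open Computability

section Missing

variable {Q α : Type} (δ : Q → α → Q)

theorem act_append (w x : List α) (q : Q) : act δ (w ++ x) q = act δ x (act δ w q) :=
  List.foldl_append

theorem kernImage_act_nil (S : Set Q) : Set.kernImage (act δ []) S = S := by
  simp [Set.kernImage, act]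

theorem kernImage_act_cons (x : α) (w : List α) (S : Set Q) :
    Set.kernImage (act δ (x :: w)) S = Set.kernImage (act δ w) (Set.kernImage (δ · x) S) := by
  simp only [Set.kernImage_eq_compl, compl_compl, Set.image_image]
  rfl

theorem kernImage_act_append (w x : List α) (S : Set Q) :
    Set.kernImage (act δ (w ++ x)) S = Set.kernImage (act δ x) (Set.kernImage (act δ w) S) := by
  simp only [Set.kernImage_eq_compl, compl_compl, Set.image_image, act_append]

theorem ncard_le_ncard_kernImage {Q : Type*} [Finite Q] (f : Q → Q) (S : Set Q) :
    S.ncard ≤ (Set.kernImage f S).ncard := by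
  have himage := Set.ncard_image_le (f := f) (Set.toFinite Sᶜ)
  have hS := Set.ncard_add_ncard_compl S
  have hfS := Set.ncard_add_ncard_compl (f '' Sᶜ)
  rw [Set.kernImage_eq_compl]
  omega

theorem deficiency_eq_ncard_kernImage [Finite Q] (w : List α) :
    deficiency δ w = (Set.kernImage (act δ w) ∅).ncard := by
  rw [deficiency, Set.kernImage_empty, Set.ncard_compl]

theorem deficiency_le_of_isInfix [Finite Q] {x w : List α} (h : x <:+: w) :
    deficiency δ x ≤ deficiency δ w := by
  obtain ⟨s, t, rfl⟩ := h
  simp only [deficiency_eq_ncard_kernImage, kernImage_act_append]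
  calc (Set.kernImage (act δ x) ∅).ncard
      ≤ (Set.kernImage (act δ x) (Set.kernImage (act δ s) ∅)).ncard :=
        Set.ncard_le_ncard (Set.kernImage_mono (Set.empty_subset _)) (Set.toFinite _)
    _ ≤ _ := ncard_le_ncard_kernImage _ _

end Missing

section Saturation

variable {σ : Type*} [DecidableEq σ]

/-- Worklist closure of `todo` under the successor function `step`, `seen` being the elements whose
successors are already listed. The result is `none` if the fuel runs out or `step` fails. -/
def saturate (step : σ → Option (List σ)) : ℕ → List σ → List σ → Option (List σ)
  | 0, _, _ => none
  | _ + 1, [], seen => some seen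
  | n + 1, s :: todo, seen =>
    if s ∈ seen then saturate step n todo seen
    else (step s).bind fun l => saturate step n (l ++ todo) (s :: seen)

theorem saturate_eq_some {step : σ → Option (List σ)} {n : ℕ} {todo seen C : List σ}
    (h : saturate step n todo seen = some C) :
    (∀ s ∈ todo ++ seen, s ∈ C) ∧ ∀ s ∈ C, s ∈ seen ∨ ∃ l, step s = some l ∧ ∀ t ∈ l, t ∈ C := by
  induction n generalizing todo seen with
  | zero => simp [saturate] at h
  | succ n ih =>
    cases todo with
    | nil =>
      obtain rfl : seen = C := by simpa [saturate] using h
      exact ⟨fun s hs => hs, fun s hs => .inl hs⟩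
    | cons s todo =>
      by_cases hs : s ∈ seen
      · obtain ⟨hsub, hclosed⟩ := ih (by simpa [saturate, hs] using h)
        exact ⟨fun t ht => hsub t (by grind), hclosed⟩
      · obtain ⟨l, hl, h⟩ : ∃ l, step s = some l ∧
            saturate step n (l ++ todo) (s :: seen) = some C := by
          simpa [saturate, hs, Option.bind_eq_some_iff] using h
        obtain ⟨hsub, hclosed⟩ := ih h
        refine ⟨fun t ht => hsub t (by grind), fun t ht => ?_⟩
        rcases hclosed t ht with hts | hstep
        · rcases List.mem_cons.1 hts with rfl | hseen
          · exact .inr ⟨l, hl, fun u hu => hsub u (by simp [hu])⟩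
          · exact .inl hseen
        · exact .inr hstep

end Saturation

theorem exists_mapM_eq_some {σ τ : Type*} {f : σ → Option τ} {p : τ → Prop} {l : List σ}
    (h : ∀ s ∈ l, ∃ t, f s = some t ∧ p t) : ∃ l', l.mapM f = some l' ∧ ∀ t ∈ l', p t := by
  induction l with
  | nil => exact ⟨[], rfl, by simp⟩
  | cons s l ih =>
    obtain ⟨⟨t, hst, ht⟩, hl⟩ := List.forall_mem_cons.1 h
    obtain ⟨l', hll', hp⟩ := ih hl
    exact ⟨t :: l', by simp [List.mapM_cons, hst, hll'], List.forall_mem_cons.2 ⟨ht, hp⟩⟩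

/-- A description of a self-map by its range and its kernel: `gap` lists the elements outside the
range; each pair of `dup` consists of a redundant element and an element with the same image, and
the map is injective off the redundant elements. -/
structure Frame (σ : Type*) where
  gap : List σ
  dup : List (σ × σ)

namespace Frame

variable {σ τ : Type*}

/-- Renaming along `ι`. -/
def map (ι : σ → τ) (F : Frame σ) : Frame τ :=
  ⟨F.gap.map ι, F.dup.map (Prod.map ι ι)⟩

/-- The elements other than the chosen representatives of the fibres. -/
def redundant (F : Frame σ) : List σ :=
  F.dup.map Prod.fst

/-- All the elements that occur in the frame. -/
def support (F : Frame σ) : List σ :=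
  F.gap ++ F.redundant ++ F.dup.map Prod.snd

/-- The representatives of the fibres that are contained in `K`. -/
def reps [DecidableEq σ] (F : Frame σ) (K : List σ) : List σ :=
  K.filter fun r => r ∉ F.redundant ∧ ∀ d ∈ F.dup, d.2 = r → d.1 ∈ K

theorem mem_reps [DecidableEq σ] {F : Frame σ} {K : List σ} {r : σ} :
    r ∈ F.reps K ↔ r ∈ K ∧ r ∉ F.redundant ∧ ∀ d ∈ F.dup, d.2 = r → d.1 ∈ K := by
  simp [reps]

theorem map_congr {ι κ : σ → τ} {F : Frame σ} (h : ∀ i ∈ F.support, ι i = κ i) :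
    F.map ι = F.map κ := by
  have hdup : ∀ d ∈ F.dup, Prod.map ι ι d = Prod.map κ κ d := fun d hd =>
    Prod.ext (h _ (by simp only [support, redundant]; grind))
      (h _ (by simp only [support, redundant]; grind))
  have hgap : ∀ i ∈ F.gap, ι i = κ i := fun i hi => h i (by simp [support, hi])
  rw [map, map, List.map_congr_left hgap, List.map_congr_left hdup]

theorem map_map {υ : Type*} (κ : τ → υ) (ι : σ → τ) (F : Frame σ) :
    (F.map ι).map κ = F.map (κ ∘ ι) := by
  simp [map]

theorem redundant_map (ι : σ → τ) (F : Frame σ) : (F.map ι).redundant = F.redundant.map ι := by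
  simp [redundant, map]

theorem support_map (ι : σ → τ) (F : Frame σ) : (F.map ι).support = F.support.map ι := by
  simp [support, redundant, map, Function.comp_def]

theorem mem_map_iff_of_injOn {N : Set σ} {ι : σ → τ} (hι : N.InjOn ι) {l : List σ}
    (hl : ∀ i ∈ l, i ∈ N) {r : σ} (hr : r ∈ N) : ι r ∈ l.map ι ↔ r ∈ l := by
  refine ⟨fun h => ?_, List.mem_map_of_mem⟩
  obtain ⟨i, hi, e⟩ := List.mem_map.1 h
  rwa [← hι (hl i hi) hr e]

theorem reps_map [DecidableEq σ] [DecidableEq τ] {N : Set σ} {ι : σ → τ} (hι : N.InjOn ι)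
    {F : Frame σ} (hF : ∀ i ∈ F.support, i ∈ N) {K : List σ} (hK : ∀ i ∈ K, i ∈ N) :
    (F.map ι).reps (K.map ι) = (F.reps K).map ι := by
  have hred : ∀ i ∈ F.redundant, i ∈ N := fun i hi => hF i (by simp [support, hi])
  have hdup : ∀ d ∈ F.dup, d.1 ∈ N ∧ d.2 ∈ N := fun d hd =>
    ⟨hred _ (List.mem_map_of_mem hd), hF _ (by simp only [support]; grind)⟩
  have hiff : ∀ r ∈ K, (ι r ∉ (F.map ι).redundant ∧
      ∀ d ∈ (F.map ι).dup, d.2 = ι r → d.1 ∈ K.map ι) ↔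
      r ∉ F.redundant ∧ ∀ d ∈ F.dup, d.2 = r → d.1 ∈ K := by
    intro r hr
    rw [redundant_map, mem_map_iff_of_injOn hι hred (hK r hr), map, List.forall_mem_map]
    refine and_congr_right fun _ => forall₂_congr fun d hd => ?_
    rw [Prod.map_fst, Prod.map_snd, hι.eq_iff (hdup d hd).2 (hK r hr),
      mem_map_iff_of_injOn hι hK (hdup d hd).1]
  rw [reps, reps, List.filter_map]
  exact congrArg _ (List.filter_congr fun r hr => decide_eq_decide.2 (hiff r hr))

/-- The frame `F` describes the map `f`. -/
structure Describes {Q : Type*} (F : Frame Q) (f : Q → Q) : Prop where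
  gap_nodup : F.gap.Nodup
  mem_gap_iff : ∀ q, q ∈ F.gap ↔ q ∉ Set.range f
  apply_eq : ∀ d ∈ F.dup, f d.1 = f d.2
  notMem_redundant : ∀ d ∈ F.dup, d.2 ∉ F.redundant
  injOn : Set.InjOn f {q | q ∉ F.redundant}

namespace Describes

variable {Q : Type*} {F : Frame Q} {f : Q → Q} {K : List Q} {S : Set Q}

theorem exists_rep (h : F.Describes f) (q : Q) : ∃ r, r ∉ F.redundant ∧ f r = f q := by
  by_cases hq : q ∈ F.redundant
  · obtain ⟨d, hd, rfl⟩ := List.mem_map.1 hq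
    exact ⟨d.2, h.notMem_redundant d hd, (h.apply_eq d hd).symm⟩
  · exact ⟨q, hq, rfl⟩

theorem eq_or_mem_dup (h : F.Describes f) {p r : Q} (hr : r ∉ F.redundant) (e : f p = f r) :
    p = r ∨ (p, r) ∈ F.dup := by
  by_cases hp : p ∈ F.redundant
  · obtain ⟨d, hd, rfl⟩ := List.mem_map.1 hp
    rw [← h.injOn (h.notMem_redundant d hd) hr ((h.apply_eq d hd).symm.trans e)]
    exact .inr hd
  · exact .inl (h.injOn hp hr e)

variable [DecidableEq Q]

theorem apply_mem_kernImage (h : F.Describes f) (hK : ∀ q ∈ K, q ∈ S) {r : Q}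
    (hr : r ∈ F.reps K) : f r ∈ Set.kernImage f S := by
  obtain ⟨hrK, hr, hdup⟩ := mem_reps.1 hr
  intro p hp
  rcases h.eq_or_mem_dup hr hp with rfl | hd
  · exact hK _ hrK
  · exact hK _ (hdup _ hd rfl)

theorem nodup_gap_append_map_reps (h : F.Describes f) (hK : K.Nodup) :
    (F.gap ++ (F.reps K).map f).Nodup := by
  refine h.gap_nodup.append ((hK.filter _).map_on fun r hr s hs e => ?_) fun q hq hq' => ?_
  · exact h.injOn (mem_reps.1 hr).2.1 (mem_reps.1 hs).2.1 e
  · obtain ⟨r, -, rfl⟩ := List.mem_map.1 hq'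
    exact (h.mem_gap_iff _).1 hq ⟨r, rfl⟩

theorem mem_kernImage (h : F.Describes f) (hK : ∀ q ∈ K, q ∈ S) {q : Q}
    (hq : q ∈ F.gap ++ (F.reps K).map f) : q ∈ Set.kernImage f S := by
  rcases List.mem_append.1 hq with hq | hq
  · exact Set.compl_range_subset_kernImage ((h.mem_gap_iff q).1 hq)
  · obtain ⟨r, hr, rfl⟩ := List.mem_map.1 hq
    exact h.apply_mem_kernImage hK hr

theorem kernImage_subset (h : F.Describes f) (K : List Q) (S : Set Q) :
    Set.kernImage f S ⊆ {q | q ∈ F.gap ++ (F.reps K).map f} ∪ f '' {q ∈ S | q ∉ K} := by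
  intro y hy
  by_contra! hnot
  simp only [Set.mem_union, Set.mem_ofPred_eq, List.mem_append, not_or, h.mem_gap_iff,
    not_not] at hnot
  obtain ⟨⟨⟨q, rfl⟩, hreps⟩, himage⟩ := hnot
  have hfibre : ∀ p, f p = f q → p ∈ K := fun p hp => by
    by_contra hpK
    exact himage ⟨p, ⟨hy hp, hpK⟩, hp⟩
  obtain ⟨r, hr, hrq⟩ := h.exists_rep q
  refine hreps (List.mem_map.2 ⟨r, mem_reps.2 ⟨hfibre r hrq, hr, ?_⟩, hrq⟩)
  rintro d hd rfl
  exact hfibre _ ((h.apply_eq d hd).trans hrq)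

theorem ncard_kernImage_le [Finite Q] (h : F.Describes f) (hK : ∀ q ∈ K, q ∈ S)
    (hK' : K.Nodup) :
    (Set.kernImage f S).ncard + K.length ≤ F.gap.length + (F.reps K).length + S.ncard := by
  have hlist (l : List Q) : {q | q ∈ l}.ncard ≤ l.length := by
    rw [← List.coe_toFinset, Set.ncard_coe_finset]
    exact l.toFinset_card_le
  have hdiff : {q ∈ S | q ∉ K}.ncard + K.length = S.ncard := by
    rw [← List.toFinset_card_of_nodup hK', ← Set.ncard_coe_finset, List.coe_toFinset]
    exact Set.ncard_sdiff_add_ncard_of_subset hK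
  have hunion := (Set.ncard_le_ncard (h.kernImage_subset K S)).trans (Set.ncard_union_le _ _)
  have himage := Set.ncard_image_le (f := f) (Set.toFinite {q ∈ S | q ∉ K})
  have hforced := hlist (F.gap ++ (F.reps K).map f)
  rw [List.length_append, List.length_map] at hforced
  omega

end Describes

end Frame

/-- A partially known semiautomaton whose states are named by numbers below `size`: a frame for
every letter, and a table of known values, recorded at non-redundant names only. -/
structure PartialAutomaton (α : Type) where
  size : ℕ
  frame : α → Frame ℕ
  table : List ((α × ℕ) × ℕ)

namespace PartialAutomaton

variable {α : Type} (P : PartialAutomaton α)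

/-- The partial automaton in which, moreover, the letter `x` sends `r` to `j`; here `j` may be a
new name. -/
def assign (x : α) (r j : ℕ) : PartialAutomaton α :=
  ⟨max P.size (j + 1), P.frame, ((x, r), j) :: P.table⟩

/-- The number of states known to be missing after `x` is read when the states in `K` were. -/
def forced (x : α) (K : List ℕ) : ℕ :=
  (P.frame x).gap.length + ((P.frame x).reps K).length

section Search

variable [DecidableEq α]

/-- The value of `x` at `r`, if it is known. -/
def value (x : α) (r : ℕ) : Option ℕ :=
  P.table.lookup (x, r)

/-- The names of the states known to be missing after `x` is read when the states in `K` were. -/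
def image (x : α) (K : List ℕ) : List ℕ :=
  (P.frame x).gap ++ ((P.frame x).reps K).filterMap (P.value x)

/-- The elements of `K` that yield a missing state without a known name. -/
def unknown (x : α) (K : List ℕ) : List ℕ :=
  ((P.frame x).reps K).filter fun r => (P.value x r).isNone

/-- Read a word from the missing states `K` until the first unknown transition; `none` means that
more than `d` missing states occur. -/
def read (d : ℕ) : List ℕ → List α → Option (List ℕ × List α)
  | K, [] => some (K, [])
  | K, x :: w =>
    if d < P.forced x K then none
    else if P.unknown x K = [] then read d (P.image x K) w
    else some (K, x :: w)

/-- The transition whose value is needed for reading on. -/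
def obstacle : List ℕ × List α → Option (α × ℕ)
  | (_, []) => none
  | (K, x :: _) => (P.unknown x K).head?.map (x, ·)

/-- The names of the possible values of an unknown transition of `x`, including a new name. -/
def candidates (x : α) : List ℕ :=
  (List.range (P.size + 1)).filter fun j =>
    j ∉ (P.frame x).gap ∧ ∀ t ∈ P.table, t.1.1 = x → t.2 ≠ j

/-- The known parts of the missing sets of at most `d` elements that arise from `K` by a word
matching a regular expression; the list `[[]]` carries no information. -/
def post (d : ℕ) : RegularExpression α → List ℕ → List (List ℕ)
  | .zero, _ => []
  | .epsilon, K => [K]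
  | .char x, K => if d < P.forced x K then [] else [P.image x K]
  | .plus R S, K => post d R K ++ post d S K
  | .comp R S, K => (post d R K).flatMap (post d S)
  | .star R, K => (saturate (fun K => some (post d R K)) 60 [K] []).getD [[]]

end Search

section Search

variable [FinEnum α]

/-- The pair `(K, k)` stands for the sets that contain `K` and at most `k` further elements. The
test closes these pairs under the letters and succeeds if none allows more than `d` elements. -/
def isClosed (d : ℕ) : Bool :=
  let step (s : List ℕ × ℕ) : Option (List (List ℕ × ℕ)) :=
    if s.1.length + s.2 ≤ d then
      some ((FinEnum.toList α).map fun x => (P.image x s.1, s.2 + (P.unknown x s.1).length))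
    else none
  (saturate step 60 [([], 0)] []).isSome

/-- The symbolic search: it succeeds if every automaton extending `P` either has no word of
deficiency more than `d`, or attains such a deficiency on one of the pending words `ws`, or on all
the words matching `R`. It branches on the first obstacle to reading the pending words or, if
there is none, the word `sample`. -/
def search (d : ℕ) (R : RegularExpression α) (sample : List α) :
    ℕ → List (List ℕ × List α) → PartialAutomaton α → Bool
  | 0, _, _ => false
  | n + 1, ws, P =>
    match ws.mapM fun s => P.read d s.1 s.2 with
    | none => true
    | some ws' =>
      P.isClosed d || (ws'.findSome? P.obstacle).isNone && (P.post d R []).isEmpty ||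
        match (ws'.findSome? P.obstacle).or ((P.read d [] sample).bind P.obstacle) with
        | none => false
        | some (x, r) =>
          (P.candidates x).all fun j => search d R sample n ws' (P.assign x r j)

end Search

variable {Q : Type} {P} {δ : Q → α → Q} {ι : ℕ → Q} {K : List ℕ} {S : Set Q} {d k n : ℕ} {x : α}
  {w : List α}

/-- `K` is a list of distinct names below `n` of elements of `S`. -/
structure Known (ι : ℕ → Q) (n : ℕ) (K : List ℕ) (S : Set Q) : Prop where
  nodup : K.Nodup
  lt : ∀ i ∈ K, i < n
  mem : ∀ i ∈ K, ι i ∈ S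

theorem Known.nil : Known ι n [] S :=
  ⟨by simp, by simp, by simp⟩

theorem Known.mono {ι' : ℕ → Q} {m : ℕ} (h : Known ι n K S) (hnm : n ≤ m)
    (hι : Set.EqOn ι' ι (Set.Iio n)) : Known ι' m K S :=
  ⟨h.nodup, fun i hi => (h.lt i hi).trans_le hnm, fun i hi => hι (h.lt i hi) ▸ h.mem i hi⟩

/-- The automaton `δ` extends the partial automaton `P`, the number `i` naming the state `ι i`. -/
structure Models (P : PartialAutomaton α) (δ : Q → α → Q) (ι : ℕ → Q) : Prop where
  injOn : Set.InjOn ι (Set.Iio P.size)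
  support_lt : ∀ x, ∀ i ∈ (P.frame x).support, i < P.size
  describes : ∀ x, ((P.frame x).map ι).Describes (δ · x)
  table_lt : ∀ t ∈ P.table, t.1.2 < P.size ∧ t.2 < P.size
  notMem_redundant : ∀ t ∈ P.table, t.1.2 ∉ (P.frame t.1.1).redundant
  apply_eq : ∀ t ∈ P.table, δ (ι t.1.2) t.1.1 = ι t.2

theorem Models.reps_map [DecidableEq Q] (h : Models P δ ι) (hK : ∀ i ∈ K, i < P.size) (x : α) :
    ((P.frame x).map ι).reps (K.map ι) = ((P.frame x).reps K).map ι :=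
  Frame.reps_map h.injOn (h.support_lt x) hK

theorem Models.forced_le [Finite Q] (h : Models P δ ι) (hK : Known ι P.size K S) (x : α) :
    P.forced x K ≤ (Set.kernImage (δ · x) S).ncard := by
  classical
  have hnodup := (h.describes x).nodup_gap_append_map_reps (hK.nodup.map_on fun i hi j hj =>
    h.injOn (hK.lt i hi) (hK.lt j hj))
  have hle := Set.ncard_le_ncard (fun q hq => (h.describes x).mem_kernImage
    (K := K.map ι) (S := S) (by simpa using hK.mem) (List.mem_toFinset.1 hq)) (Set.toFinite _)
  rw [Set.ncard_coe_finset, List.toFinset_card_of_nodup hnodup, h.reps_map hK.lt] at hle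
  simpa [Frame.map, forced] using hle

/-- The state of reading a word: `w` remains to be read from missing states that contain `K`, and
at most `d` states are missing in the end. -/
def Pending (δ : Q → α → Q) (ι : ℕ → Q) (n d : ℕ) (s : List ℕ × List α) : Prop :=
  ∃ S : Set Q, Known ι n s.1 S ∧ (Set.kernImage (act δ s.2) S).ncard ≤ d

theorem Pending.mono {ι' : ℕ → Q} {m : ℕ} {s : List ℕ × List α} (h : Pending δ ι n d s)
    (hnm : n ≤ m) (hι : Set.EqOn ι' ι (Set.Iio n)) : Pending δ ι' m d s := by
  obtain ⟨S, hK, hS⟩ := h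
  exact ⟨S, hK.mono hnm hι, hS⟩

theorem exists_known_of_mem_kstar [Finite Q] {l : Language α} {C : List (List ℕ)}
    (hC : ∀ w ∈ l, ∀ K ∈ C, ∀ S : Set Q, Known ι n K S →
      (Set.kernImage (act δ w) S).ncard ≤ d → ∃ K' ∈ C, Known ι n K' (Set.kernImage (act δ w) S))
    (hw : w ∈ l∗) (hKC : K ∈ C) (hK : Known ι n K S)
    (hS : (Set.kernImage (act δ w) S).ncard ≤ d) :
    ∃ K' ∈ C, Known ι n K' (Set.kernImage (act δ w) S) := by
  obtain ⟨vs, rfl, hvs⟩ := Language.mem_kstar.1 hw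
  clear hw
  induction vs generalizing K S with
  | nil => exact ⟨K, hKC, by rwa [List.flatten_nil, kernImage_act_nil]⟩
  | cons v vs ih =>
    rw [List.flatten_cons, kernImage_act_append] at hS ⊢
    obtain ⟨hv, hvs⟩ := List.forall_mem_cons.1 hvs
    obtain ⟨K', hK', hKS⟩ := hC v hv K hKC S hK ((ncard_le_ncard_kernImage _ _).trans hS)
    exact ih hK' hKS hvs hS

section Soundness

variable [DecidableEq α]

theorem mem_table_of_value_eq_some {r j : ℕ} (h : P.value x r = some j) :
    ((x, r), j) ∈ P.table := by
  obtain ⟨l₁, l₂, h, -⟩ := List.lookup_eq_some_iff.1 h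
  simp [h]

theorem length_image_add_length_unknown (P : PartialAutomaton α) (x : α) (K : List ℕ) :
    (P.image x K).length + (P.unknown x K).length = P.forced x K := by
  simp only [image, unknown, forced, List.length_append, add_assoc]
  congr 1
  induction (P.frame x).reps K with
  | nil => simp
  | cons r l ih => cases hr : P.value x r <;> simp [hr, ← ih] <;> omega

namespace Models

theorem map_image_sublist [DecidableEq Q] (h : Models P δ ι) (hK : ∀ i ∈ K, i < P.size) (x : α) :
    ((P.image x K).map ι).Sublist
      (((P.frame x).map ι).gap ++ (((P.frame x).map ι).reps (K.map ι)).map (δ · x)) := by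
  rw [h.reps_map hK, image, List.map_append, List.map_map]
  refine List.Sublist.append_left ?_ _
  induction (P.frame x).reps K with
  | nil => simp
  | cons r l ih =>
    cases hr : P.value x r with
    | none => simpa [List.filterMap_cons, hr] using ih.cons _
    | some j =>
      simpa [List.filterMap_cons, hr, h.apply_eq _ (mem_table_of_value_eq_some hr)] using ih

theorem known_image (h : Models P δ ι) (hK : Known ι P.size K S) (x : α) :
    Known ι P.size (P.image x K) (Set.kernImage (δ · x) S) := by
  classical
  have hmap := h.map_image_sublist hK.lt x
  refine ⟨.of_map ι (hmap.nodup ?_), fun i hi => ?_, fun i hi => ?_⟩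
  · exact (h.describes x).nodup_gap_append_map_reps (hK.nodup.map_on fun i hi j hj =>
      h.injOn (hK.lt i hi) (hK.lt j hj))
  · rcases List.mem_append.1 hi with hi | hi
    · exact h.support_lt x i (by simp [Frame.support, hi])
    · obtain ⟨r, -, hr⟩ := List.mem_filterMap.1 hi
      exact (h.table_lt _ (mem_table_of_value_eq_some hr)).2
  · exact (h.describes x).mem_kernImage (by simpa using hK.mem)
      (hmap.subset (List.mem_map_of_mem hi))

theorem ncard_kernImage_le [Finite Q] (h : Models P δ ι) (hK : Known ι P.size K S)
    (hS : S.ncard ≤ K.length + k) (x : α) :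
    (Set.kernImage (δ · x) S).ncard ≤ (P.image x K).length + (k + (P.unknown x K).length) := by
  classical
  have hle := (h.describes x).ncard_kernImage_le (K := K.map ι) (S := S)
    (by simpa using hK.mem) (hK.nodup.map_on fun i hi j hj => h.injOn (hK.lt i hi) (hK.lt j hj))
  have hforced := length_image_add_length_unknown P x K
  rw [h.reps_map hK.lt] at hle
  simp only [Frame.map, List.length_map] at hle
  rw [forced] at hforced
  omega

end Models

theorem Models.exists_known_of_read (h : Models P δ ι) (hK : Known ι P.size K S)
    {s : List ℕ × List α} (hs : P.read d K w = some s) :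
    ∃ T, Known ι P.size s.1 T ∧
      Set.kernImage (act δ s.2) T = Set.kernImage (act δ w) S := by
  induction w generalizing K S with
  | nil =>
    obtain rfl := Option.some_inj.1 hs
    exact ⟨S, hK, rfl⟩
  | cons x w ih =>
    obtain ⟨-, hs⟩ := Option.ite_none_left_eq_some.1 hs
    split_ifs at hs
    · rw [kernImage_act_cons]
      exact ih (h.known_image hK x) hs
    · obtain rfl := Option.some_inj.1 hs
      exact ⟨S, hK, rfl⟩

theorem Models.read_ne_none [Finite Q] (h : Models P δ ι) (hK : Known ι P.size K S)
    (hS : (Set.kernImage (act δ w) S).ncard ≤ d) : P.read d K w ≠ none := by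
  induction w generalizing K S with
  | nil => simp [read]
  | cons x w ih =>
    rw [kernImage_act_cons] at hS
    have hforced : ¬d < P.forced x K :=
      ((h.forced_le hK x).trans ((ncard_le_ncard_kernImage _ _).trans hS)).not_gt
    rw [read, if_neg hforced]
    split_ifs
    · exact ih (h.known_image hK x) hS
    · simp

theorem Models.exists_read_eq_some [Finite Q] (h : Models P δ ι) {s : List ℕ × List α}
    (hs : Pending δ ι P.size d s) :
    ∃ s', P.read d s.1 s.2 = some s' ∧ Pending δ ι P.size d s' := by
  obtain ⟨S, hK, hS⟩ := hs
  obtain ⟨s', hs'⟩ := Option.ne_none_iff_exists'.1 (h.read_ne_none hK hS)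
  obtain ⟨T, hKT, hT⟩ := h.exists_known_of_read hK hs'
  exact ⟨s', hs', T, hKT, hT ▸ hS⟩

theorem Models.exists_post [Finite Q] (h : Models P δ ι) {R : RegularExpression α}
    (hw : w ∈ R.matches') (hK : Known ι P.size K S)
    (hS : (Set.kernImage (act δ w) S).ncard ≤ d) :
    ∃ K' ∈ P.post d R K, Known ι P.size K' (Set.kernImage (act δ w) S) := by
  induction R generalizing w K S with
  | zero => exact absurd hw (Set.notMem_empty w)
  | epsilon =>
    obtain rfl : w = [] := hw
    exact ⟨K, by simp [post], by rwa [kernImage_act_nil]⟩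
  | char x =>
    obtain rfl : w = [x] := hw
    rw [kernImage_act_cons, kernImage_act_nil] at hS ⊢
    exact ⟨_, by simp [post, ((h.forced_le hK x).trans hS).not_gt], h.known_image hK x⟩
  | plus R T hR hT =>
    rcases hw with hw | hw
    · obtain ⟨K', hK', hKS⟩ := hR hw hK hS
      exact ⟨K', List.mem_append_left _ hK', hKS⟩
    · obtain ⟨K', hK', hKS⟩ := hT hw hK hS
      exact ⟨K', List.mem_append_right _ hK', hKS⟩
  | comp R T hR hT =>
    obtain ⟨v, hv, w, hw', rfl⟩ := Language.mem_mul.1 hw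
    rw [kernImage_act_append] at hS ⊢
    obtain ⟨K', hK', hKS⟩ := hR hv hK ((ncard_le_ncard_kernImage _ _).trans hS)
    obtain ⟨K'', hK'', hKS'⟩ := hT hw' hKS hS
    exact ⟨K'', List.mem_flatMap.2 ⟨K', hK', hK''⟩, hKS'⟩
  | star R hR =>
    rw [post]
    cases hC : saturate (fun K => some (P.post d R K)) 60 [K] [] with
    | none => exact ⟨[], by simp, .nil⟩
    | some C =>
      obtain ⟨hKC, hclosed⟩ := saturate_eq_some hC
      refine exists_known_of_mem_kstar (fun v hv K hK S hKS hS => ?_) hw (hKC K (by simp)) hK hS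
      obtain ⟨K', hK', hKS'⟩ := hR hv hKS hS
      rcases hclosed K hK with hK | ⟨l, hl, hlC⟩
      · exact absurd hK List.not_mem_nil
      · exact ⟨K', hlC K' (Option.some_inj.1 hl ▸ hK'), hKS'⟩

end Soundness

theorem Models.isClosed_sound {α : Type} [FinEnum α] {P : PartialAutomaton α} {δ : Q → α → Q}
    [Finite Q] (h : Models P δ ι) (hclosed : P.isClosed d) (w : List α) : deficiency δ w ≤ d := by
  obtain ⟨C, hC⟩ := Option.isSome_iff_exists.1 hclosed
  obtain ⟨hinit, hstep⟩ := saturate_eq_some hC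
  have hbound : ∀ s ∈ C, ∀ S : Set Q, Known ι P.size s.1 S → S.ncard ≤ s.1.length + s.2 →
      (Set.kernImage (act δ w) S).ncard ≤ d := by
    induction w with
    | nil =>
      intro s hs S _ hS
      obtain ⟨l, hl, -⟩ := (hstep s hs).resolve_left (by simp)
      rw [kernImage_act_nil]
      exact hS.trans (by simpa using (Option.ite_none_right_eq_some.1 hl).1)
    | cons x w ih =>
      intro s hs S hK hS
      obtain ⟨l, hl, hsub⟩ := (hstep s hs).resolve_left (by simp)
      obtain rfl := Option.some_inj.1 (Option.ite_none_right_eq_some.1 hl).2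
      rw [kernImage_act_cons]
      exact ih _ (hsub _ (List.mem_map_of_mem (FinEnum.mem_toList x))) _ (h.known_image hK x)
        (h.ncard_kernImage_le hK hS x)
  rw [deficiency_eq_ncard_kernImage]
  exact hbound ([], 0) (hinit _ (by simp)) ∅ .nil (by simp)

theorem exists_name (hι : Set.InjOn ι (Set.Iio n)) (q : Q) :
    ∃ j ≤ n, ∃ ι' : ℕ → Q, Set.EqOn ι' ι (Set.Iio n) ∧
      Set.InjOn ι' (Set.Iio (max n (j + 1))) ∧ ι' j = q := by
  by_cases hq : q ∈ ι '' Set.Iio n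
  · obtain ⟨j, hj, rfl⟩ := hq
    exact ⟨j, hj.le, ι, Set.eqOn_refl _ _, by rwa [max_eq_left (Nat.succ_le_of_lt hj)], rfl⟩
  · have heq : Set.EqOn (Function.update ι n q) ι (Set.Iio n) := fun i hi =>
      Function.update_of_ne hi.ne _ _
    refine ⟨n, le_rfl, Function.update ι n q, heq, ?_, Function.update_self ..⟩
    rw [max_eq_right n.le_succ, ← Nat.succ_eq_succ, Order.Iio_succ_eq_insert,
      Set.injOn_insert (by simp), heq.image_eq, Function.update_self]
    exact ⟨hι.congr heq.symm, hq⟩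

theorem Models.rename {ι' : ℕ → Q} {m : ℕ} (h : Models P δ ι) (hm : P.size ≤ m)
    (heq : Set.EqOn ι' ι (Set.Iio P.size)) (hι' : Set.InjOn ι' (Set.Iio m)) :
    Models ⟨m, P.frame, P.table⟩ δ ι' where
  injOn := hι'
  support_lt x i hi := (h.support_lt x i hi).trans_le hm
  describes x := by
    rw [Frame.map_congr fun i hi => heq (h.support_lt x i hi)]
    exact h.describes x
  table_lt t ht := ⟨(h.table_lt t ht).1.trans_le hm, (h.table_lt t ht).2.trans_le hm⟩
  notMem_redundant := h.notMem_redundant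
  apply_eq t ht := by
    rw [heq (h.table_lt t ht).1, heq (h.table_lt t ht).2]
    exact h.apply_eq t ht

theorem Models.assign {ι' : ℕ → Q} {r j : ℕ} (h : Models P δ ι) (hr : r < P.size)
    (hred : r ∉ (P.frame x).redundant) (heq : Set.EqOn ι' ι (Set.Iio P.size))
    (hι' : Set.InjOn ι' (Set.Iio (max P.size (j + 1)))) (hj : ι' j = δ (ι r) x) :
    Models (P.assign x r j) δ ι' := by
  have hrename := h.rename (le_max_left _ _) heq hι'
  refine ⟨hι', hrename.support_lt, hrename.describes, List.forall_mem_cons.2 ⟨?_, hrename.table_lt⟩,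
    List.forall_mem_cons.2 ⟨hred, h.notMem_redundant⟩,
    List.forall_mem_cons.2 ⟨?_, hrename.apply_eq⟩⟩
  · exact ⟨hr.trans_le (le_max_left _ _), Nat.lt_of_succ_le (le_max_right _ _)⟩
  · rw [hj, heq hr]

theorem Models.fst_eq_of_mem_table {r : ℕ} (h : Models P δ ι) (hr : r < P.size)
    (hred : r ∉ (P.frame x).redundant) {t : (α × ℕ) × ℕ} (ht : t ∈ P.table) (hx : t.1.1 = x)
    (htr : ι t.2 = δ (ι r) x) : t.1 = (x, r) := by
  subst hx
  have hnot : ∀ i < P.size, i ∉ (P.frame t.1.1).redundant →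
      ι i ∉ ((P.frame t.1.1).map ι).redundant := fun i hi hired => by
    rwa [Frame.redundant_map, Frame.mem_map_iff_of_injOn h.injOn (fun k hk => h.support_lt t.1.1 k
      (by simp [Frame.support, hk])) hi]
  exact Prod.ext rfl (h.injOn (h.table_lt t ht).1 hr ((h.describes t.1.1).injOn
    (hnot _ (h.table_lt t ht).1 (h.notMem_redundant t ht)) (hnot r hr hred)
    ((h.apply_eq t ht).trans htr)))

section Soundness

variable [DecidableEq α]

theorem Models.exists_candidate {r : ℕ} (h : Models P δ ι) (hr : r < P.size)
    (hred : r ∉ (P.frame x).redundant) (hval : P.value x r = none) :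
    ∃ j ∈ P.candidates x, ∃ ι' : ℕ → Q, Set.EqOn ι' ι (Set.Iio P.size) ∧
      Models (P.assign x r j) δ ι' := by
  obtain ⟨j, hjn, ι', heq, hι', hj⟩ := exists_name h.injOn (δ (ι r) x)
  refine ⟨j, List.mem_filter.2 ⟨List.mem_range.2 (Nat.lt_succ_of_le hjn), ?_⟩, ι', heq,
    h.assign hr hred heq hι' hj⟩
  refine decide_eq_true ⟨fun hgap => ?_, fun t ht hx htj => ?_⟩
  · have hlt : j < P.size := h.support_lt x j (by simp [Frame.support, hgap])
    refine ((h.describes x).mem_gap_iff (ι j)).1 (List.mem_map_of_mem hgap) ⟨ι r, ?_⟩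
    rw [← heq hlt, hj]
  · have htr := h.fst_eq_of_mem_table hr hred ht hx (by rw [← hj, ← htj, heq (h.table_lt t ht).2])
    rw [value, List.lookup_eq_none_iff] at hval
    exact absurd (hval t ht) (by simp [htr])

theorem exists_mem_unknown {s : List ℕ × List α} {r : ℕ} (h : P.obstacle s = some (x, r)) :
    r ∈ P.unknown x s.1 := by
  obtain ⟨K, _ | ⟨y, w⟩⟩ := s
  · simp [obstacle] at h
  · obtain ⟨_, hr, he⟩ := Option.map_eq_some_iff.1 h
    obtain ⟨rfl, rfl⟩ := Prod.mk.inj he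
    exact List.mem_of_mem_head? hr

theorem Models.exists_candidate_of_obstacle {r : ℕ} (h : Models P δ ι) {s : List ℕ × List α}
    (hs : Known ι P.size s.1 S) (hobs : P.obstacle s = some (x, r)) :
    ∃ j ∈ P.candidates x, ∃ ι' : ℕ → Q, Set.EqOn ι' ι (Set.Iio P.size) ∧
      Models (P.assign x r j) δ ι' := by
  obtain ⟨hreps, hval⟩ := List.mem_filter.1 (exists_mem_unknown hobs)
  obtain ⟨hrK, hred, -⟩ := Frame.mem_reps.1 hreps
  exact h.exists_candidate (hs.lt r hrK) hred (by simpa using hval)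

end Soundness

theorem search_sound {α : Type} [FinEnum α] [Finite Q] {δ : Q → α → Q} {R : RegularExpression α}
    {sample : List α} {ws : List (List ℕ × List α)} {P : PartialAutomaton α} {ι : ℕ → Q}
    (hsearch : search d R sample n ws P) (h : Models P δ ι)
    (hws : ∀ s ∈ ws, Pending δ ι P.size d s) (hR : ∃ w ∈ R.matches', deficiency δ w ≤ d)
    (w : List α) : deficiency δ w ≤ d := by
  induction n generalizing ws P ι with
  | zero => simp [search] at hsearch
  | succ n ih =>
    obtain ⟨ws', hread, hws'⟩ :=
      exists_mapM_eq_some fun s hs => h.exists_read_eq_some (hws s hs)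
    simp only [search, hread, Bool.or_eq_true, Bool.and_eq_true] at hsearch
    rcases hsearch with (hclosed | ⟨-, hpost⟩) | hbranch
    · exact h.isClosed_sound hclosed w
    · obtain ⟨v, hv, hle⟩ := hR
      rw [deficiency_eq_ncard_kernImage] at hle
      obtain ⟨K, hK, -⟩ := h.exists_post hv .nil hle
      rw [List.isEmpty_iff.1 hpost] at hK
      exact absurd hK List.not_mem_nil
    · split at hbranch
      · contradiction
      next x r hobs =>
        obtain ⟨s, S, hs, hsr⟩ : ∃ s, ∃ S : Set Q, Known ι P.size s.1 S ∧
            P.obstacle s = some (x, r) := by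
          rcases Option.or_eq_some_iff.1 hobs with hobs | ⟨-, hobs⟩
          · obtain ⟨s, hs, hsr⟩ := List.exists_of_findSome?_eq_some hobs
            obtain ⟨S, hK, -⟩ := hws' s hs
            exact ⟨s, S, hK, hsr⟩
          · obtain ⟨s, hs, hsr⟩ := Option.bind_eq_some_iff.1 hobs
            obtain ⟨T, hK, -⟩ := h.exists_known_of_read (S := ∅) .nil hs
            exact ⟨s, T, hK, hsr⟩
        obtain ⟨j, hj, ι', heq, hmodels⟩ := h.exists_candidate_of_obstacle hs hsr
        exact ih (List.all_eq_true.1 hbranch j hj) hmodels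
          (fun s hs => (hws' s hs).mono (le_max_left _ _) heq)

end PartialAutomaton

/-- The five shapes of a letter `x` for which `xx` has deficiency at most two: `x` is bijective, or
it identifies the two states it misses with a third one, or each of the two with a partner of its
own, or it misses one state and identifies it with another one, or it misses one state and
identifies two other ones. -/
inductive Shape
  | bijective | triple | twoPairs | innerPair | outerPair

namespace Shape

/-- The number of states named in the frame of a shape. -/
def size : Shape → ℕ
  | bijective => 0
  | triple => 3
  | twoPairs => 4
  | innerPair => 2
  | outerPair => 3

/-- The frame common to the maps of a given shape, up to the naming of states by numbers. -/
def frame : Shape → Frame ℕ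
  | bijective => ⟨[], []⟩
  | triple => ⟨[0, 1], [(0, 2), (1, 2)]⟩
  | twoPairs => ⟨[0, 2], [(0, 1), (2, 3)]⟩
  | innerPair => ⟨[0], [(0, 1)]⟩
  | outerPair => ⟨[2], [(0, 1)]⟩

theorem lt_size_of_mem_support (s : Shape) : ∀ i ∈ s.frame.support, i < s.size := by
  cases s <;> decide

/-- The map `f` has the shape `s`. -/
def Fits {Q : Type*} (s : Shape) (f : Q → Q) : Prop :=
  ∃ κ : ℕ → Q, Set.InjOn κ (Set.Iio s.size) ∧ (s.frame.map κ).Describes f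

end Shape

section Classification

variable {Q : Type*} {f : Q → Q}

theorem Shape.fits_of_nodup {s : Shape} {l : List Q} {q : Q} (hl : l.Nodup)
    (hlen : l.length = s.size) (h : (s.frame.map fun i => l.getD i q).Describes f) : s.Fits f := by
  refine ⟨_, fun i hi j hj hij => ?_, h⟩
  rw [Set.mem_Iio, ← hlen] at hi hj
  rwa [List.getD_eq_getElem _ _ hi, List.getD_eq_getElem _ _ hj, hl.getElem_inj_iff] at hij

theorem Frame.describes_of_injOn_range {l : List Q} {mate : Q → Q} (hl : l.Nodup)
    (hmem : ∀ q, q ∈ l ↔ q ∉ Set.range f) (hinj : Set.InjOn f (Set.range f))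
    (hmate : ∀ q, mate q ∈ Set.range f ∧ f (mate q) = f q) :
    (⟨l, l.map fun g => (g, mate g)⟩ : Frame Q).Describes f := by
  have hred : (⟨l, l.map fun g => (g, mate g)⟩ : Frame Q).redundant = l := by
    simp [Frame.redundant, Function.comp_def]
  refine ⟨hl, hmem, List.forall_mem_map.2 fun g _ => (hmate g).2.symm,
    List.forall_mem_map.2 fun g _ => ?_, ?_⟩
  · rw [hred, hmem, not_not]
    exact (hmate g).1
  · simp only [hred, hmem, not_not]
    exact hinj

theorem Shape.bijective_fits [Nonempty Q] (hf : f.Bijective) : Shape.bijective.Fits f :=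
  fits_of_nodup (l := []) (q := Classical.arbitrary Q) List.nodup_nil rfl
    ⟨List.nodup_nil, fun q => by simpa [Frame.map, frame] using hf.surjective q,
      by simp [Frame.map, frame], by simp [Frame.map, frame], hf.injective.injOn⟩

variable [Finite Q]

theorem exists_mate (h : Set.InjOn f (Set.range f)) :
    ∃ mate : Q → Q, ∀ q, mate q ∈ Set.range f ∧ f (mate q) = f q := by
  have hstable : f '' Set.range f = Set.range f :=
    Set.eq_of_subset_of_ncard_le (Set.image_subset_range _ _) h.ncard_image.ge (Set.toFinite _)
  have hq : ∀ q, ∃ m, m ∈ Set.range f ∧ f m = f q := fun q => by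
    rw [← Set.mem_image, hstable]
    exact Set.mem_range_self q
  exact ⟨fun q => (hq q).choose, fun q => (hq q).choose_spec⟩

theorem Shape.innerPair_fits {g : Q} (hgap : (Set.range f)ᶜ = {g})
    (hinj : Set.InjOn f (Set.range f)) : Shape.innerPair.Fits f := by
  have hmem : ∀ q, q ∈ [g] ↔ q ∉ Set.range f := fun q => by
    rw [← Set.mem_compl_iff, hgap, List.mem_singleton, Set.mem_singleton_iff]
  obtain ⟨mate, hmate⟩ := exists_mate hinj
  have hne : g ≠ mate g := fun e => (hmem g).1 (by simp) (e ▸ (hmate g).1)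
  exact fits_of_nodup (l := [g, mate g]) (q := g) (by simpa using hne) rfl
    (Frame.describes_of_injOn_range (mate := mate) (List.nodup_singleton g) hmem hinj hmate)

theorem Shape.exists_fits_of_pair {g g' : Q} (hne : g ≠ g') (hgap : (Set.range f)ᶜ = {g, g'})
    (hinj : Set.InjOn f (Set.range f)) : ∃ s : Shape, s.Fits f := by
  have hmem : ∀ q, q ∈ [g, g'] ↔ q ∉ Set.range f := fun q => by
    simp only [← Set.mem_compl_iff, hgap, List.mem_cons, List.not_mem_nil, or_false,
      Set.mem_insert_iff, Set.mem_singleton_iff]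
  obtain ⟨mate, hmate⟩ := exists_mate hinj
  have hg : ∀ q, g ≠ mate q := fun q e => (hmem g).1 (by simp) (e ▸ (hmate q).1)
  have hg' : ∀ q, g' ≠ mate q := fun q e => (hmem g').1 (by simp) (e ▸ (hmate q).1)
  have hdescribes := Frame.describes_of_injOn_range (by simpa using hne) hmem hinj hmate
  by_cases he : mate g = mate g'
  · refine ⟨triple, fits_of_nodup (l := [g, g', mate g]) (q := g)
      (by simp [hne, hg, hg']) rfl ?_⟩
    simpa [Frame.map, frame, ← he] using hdescribes
  · exact ⟨twoPairs, fits_of_nodup (l := [g, mate g, g', mate g']) (q := g)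
      (by simp [hne, hg, hg', he, (hg' g).symm]) rfl hdescribes⟩

theorem Shape.outerPair_fits {g p p' : Q} (hgap : (Set.range f)ᶜ = {g}) (hp : p ∈ Set.range f)
    (hp' : p' ∈ Set.range f) (hne : p ≠ p') (he : f p = f p') : Shape.outerPair.Fits f := by
  have hmem : ∀ q, q ∈ [g] ↔ q ∉ Set.range f := fun q => by
    rw [← Set.mem_compl_iff, hgap, List.mem_singleton, Set.mem_singleton_iff]
  have himage : f '' {p}ᶜ = Set.range f := by
    refine (Set.image_subset_range ..).antisymm (Set.range_subset_iff.2 fun q => ?_)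
    by_cases hq : q = p
    · exact ⟨p', hne.symm, by rw [hq, he]⟩
    · exact ⟨q, hq, rfl⟩
  have hinj : Set.InjOn f {p}ᶜ := by
    refine Set.injOn_of_ncard_image_eq ?_ (Set.toFinite _)
    have hrange := Set.ncard_add_ncard_compl (Set.range f)
    have hcompl := Set.ncard_add_ncard_compl {p}
    rw [Set.ncard_singleton] at hcompl
    rw [hgap, Set.ncard_singleton] at hrange
    rw [himage]
    omega
  have hpg : p ≠ g := fun e => (hmem g).1 (by simp) (e ▸ hp)
  have hpg' : p' ≠ g := fun e => (hmem g).1 (by simp) (e ▸ hp')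
  refine fits_of_nodup (l := [p, p', g]) (q := g) (by simp [hne, hpg, hpg']) rfl
    ⟨List.nodup_singleton g, hmem, ?_, ?_, ?_⟩
  · simpa [Frame.map, frame] using he
  · simpa [Frame.map, frame, Frame.redundant] using hne.symm
  · simpa [Frame.map, frame, Frame.redundant, Set.compl_def] using hinj

theorem Shape.exists_fits [Nonempty Q] (h : (Set.kernImage f (Set.kernImage f ∅)).ncard ≤ 2) :
    ∃ s : Shape, s.Fits f := by
  rw [Set.kernImage_empty, Set.kernImage_eq_compl, compl_compl] at h
  have hrange := Set.ncard_add_ncard_compl (Set.range f)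
  have himage := Set.ncard_add_ncard_compl (f '' Set.range f)
  have hle := Set.ncard_image_le (f := f) (Set.toFinite (Set.range f))
  by_cases hsurj : f.Surjective
  · exact ⟨_, Shape.bijective_fits (Finite.surjective_iff_bijective.1 hsurj)⟩
  have hpos : (Set.range f)ᶜ.ncard ≠ 0 := by
    rwa [Ne, Set.ncard_eq_zero, Set.compl_empty_iff, Set.range_eq_univ]
  by_cases hinj : Set.InjOn f (Set.range f)
  · obtain hone | htwo : (Set.range f)ᶜ.ncard = 1 ∨ (Set.range f)ᶜ.ncard = 2 := by omega
    · obtain ⟨g, hg⟩ := Set.ncard_eq_one.1 hone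
      exact ⟨_, Shape.innerPair_fits hg hinj⟩
    · obtain ⟨g, g', hne, hg⟩ := Set.ncard_eq_two.1 htwo
      exact Shape.exists_fits_of_pair hne hg hinj
  · have hlt : (f '' Set.range f).ncard ≠ (Set.range f).ncard := fun e =>
      hinj (Set.injOn_of_ncard_image_eq e (Set.toFinite _))
    obtain ⟨g, hg⟩ := Set.ncard_eq_one.1 (show (Set.range f)ᶜ.ncard = 1 by omega)
    simp only [Set.InjOn, not_forall] at hinj
    obtain ⟨p, hp, p', hp', he, hne⟩ := hinj
    exact ⟨_, Shape.outerPair_fits hg hp hp' hne he⟩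

end Classification

section Placement

/-- The ways of naming `k` distinct states when the numbers below `n` are names already: each result
lists the names of the `k` states and gives a bound above all the names in use. -/
def placements : ℕ → ℕ → List (List ℕ × ℕ)
  | 0, n => [([], n)]
  | k + 1, n => (List.range (n + 1)).flatMap fun j =>
      ((placements k (max n (j + 1))).filter fun e => j ∉ e.1).map fun e => (j :: e.1, e.2)

theorem exists_placement {Q : Type} {ι : ℕ → Q} {n : ℕ} {l : List Q}
    (hι : Set.InjOn ι (Set.Iio n)) (hl : l.Nodup) :
    ∃ e ∈ placements l.length n, ∃ ι' : ℕ → Q, Set.EqOn ι' ι (Set.Iio n) ∧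
      Set.InjOn ι' (Set.Iio e.2) ∧ n ≤ e.2 ∧ (∀ j ∈ e.1, j < e.2) ∧ e.1.map ι' = l := by
  induction l generalizing ι n with
  | nil => exact ⟨([], n), by simp [placements], ι, Set.eqOn_refl _ _, hι, le_rfl, by simp, rfl⟩
  | cons q l ih =>
    obtain ⟨hq, hl'⟩ := List.nodup_cons.1 hl
    obtain ⟨j, hj, κ, heq, hκ, rfl⟩ := PartialAutomaton.exists_name hι q
    obtain ⟨e, he, ι', heq', hι', hle, hlt, rfl⟩ := ih hκ hl'
    have hjι' : ι' j = κ j := heq' (Nat.lt_of_succ_le (le_max_right n (j + 1)))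
    have hje : j ∉ e.1 := fun h => hq (hjι' ▸ List.mem_map_of_mem h)
    have hj_lt : j < e.2 := Nat.lt_of_succ_le ((le_max_right _ _).trans hle)
    refine ⟨(j :: e.1, e.2), ?_, ι', fun i hi => ?_, hι', (le_max_left _ _).trans hle,
      List.forall_mem_cons.2 ⟨hj_lt, hlt⟩, by rw [List.map_cons, hjι']⟩
    · exact List.mem_flatMap.2 ⟨j, List.mem_range.2 (Nat.lt_succ_of_le hj),
        List.mem_map.2 ⟨e, List.mem_filter.2 ⟨he, decide_eq_true hje⟩, rfl⟩⟩
    · rw [heq' (Set.Iio_subset_Iio (le_max_left _ _) hi), heq hi]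

/-- The partial automaton over `{a, b}` with frames of shapes `s` and `t`, the states in the frame
of `b` being named according to the placement `e`. -/
def Shape.glue (s t : Shape) (e : List ℕ × ℕ) : PartialAutomaton (Fin 2) :=
  ⟨e.2, ![s.frame, t.frame.map fun i => e.1.getD i 0], []⟩

theorem Shape.exists_models_glue {Q : Type} {δ : Q → Fin 2 → Q} {s t : Shape}
    (hs : s.Fits (δ · a)) (ht : t.Fits (δ · b)) :
    ∃ e ∈ placements t.size s.size, ∃ ι : ℕ → Q, (s.glue t e).Models δ ι := by
  obtain ⟨κ, hκ, hs⟩ := hs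
  obtain ⟨κ', hκ', ht⟩ := ht
  have hnodup : ((List.range t.size).map κ').Nodup := List.nodup_range.map_on fun i hi j hj =>
    hκ' (List.mem_range.1 hi) (List.mem_range.1 hj)
  obtain ⟨e, he, ι, heq, hι, hle, hlt, hmap⟩ := exists_placement hκ hnodup
  rw [List.length_map, List.length_range] at he
  have hlen : e.1.length = t.size := by simpa using congrArg List.length hmap
  have hname : ∀ i < t.size, e.1.getD i 0 < e.2 ∧ ι (e.1.getD i 0) = κ' i := fun i hi => by
    rw [← hlen] at hi
    have hi' := congrArg (fun l : List Q => l[i]?) hmap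
    rw [List.getD_eq_getElem _ _ hi]
    exact ⟨hlt _ (List.getElem_mem hi), by simpa [hi, hlen ▸ hi] using hi'⟩
  refine ⟨e, he, ι, hι, Fin.forall_fin_two.2 ⟨fun i hi => ?_, fun i hi => ?_⟩,
    Fin.forall_fin_two.2 ⟨?_, ?_⟩, by simp [glue], by simp [glue], by simp [glue]⟩
  · exact (s.lt_size_of_mem_support i hi).trans_le hle
  · obtain ⟨k, hk, rfl⟩ := List.mem_map.1 (Frame.support_map _ t.frame ▸ hi)
    exact (hname k (t.lt_size_of_mem_support k hk)).1
  · exact (Frame.map_congr fun i hi => heq (s.lt_size_of_mem_support i hi)) ▸ hs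
  · change ((t.frame.map _).map ι).Describes _
    rw [Frame.map_map, Frame.map_congr (ι := ι ∘ _) (κ := κ') fun i hi =>
      (hname i (t.lt_size_of_mem_support i hi)).2]
    exact ht

end Placement

section Certificates

open RegularExpression in
/-- A regular expression for the language `𝓛`. -/
def regexL : RegularExpression (Fin 2) :=
  char b * (char a * (char a).star * char b).star *
    (char b * char a * (char b * char a).star) * char a * (char b * char a).star *
    (char a * char b) * (char b + char a * (char b * char b))

theorem singleton_mul_singleton {α : Type*} (v w : List α) :
    ({v} * {w} : Language α) = {v ++ w} :=
  Set.image2_singleton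

theorem regexL_matches' : regexL.matches' = L := by
  simp only [regexL, L, RegularExpression.matches'_mul, RegularExpression.matches'_add,
    RegularExpression.matches'_star, RegularExpression.matches'_char, singleton_mul_singleton,
    List.singleton_append]

theorem mem_L_of_rmatch {w : List (Fin 2)} (h : regexL.rmatch w) : w ∈ L := by
  rwa [← regexL_matches', ← RegularExpression.rmatch_iff_matches']

/-- The search over all ways of gluing letters `a` and `b` of shapes `s` and `t`, with the
words `ws` pending and `u` as the sample of `𝓛`. -/
def Shape.verify (s t : Shape) (ws : List (List (Fin 2))) : Bool :=
  (placements t.size s.size).all fun e =>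
    PartialAutomaton.search 2 regexL u 30 (ws.map fun w => ([], w)) (s.glue t e)

theorem Shape.deficiency_le_of_verify {Q : Type} [Finite Q] {δ : Q → Fin 2 → Q} {s t : Shape}
    {ws : List (List (Fin 2))} (hverify : s.verify t ws) (hs : s.Fits (δ · a))
    (ht : t.Fits (δ · b)) (hws : ∀ w ∈ ws, deficiency δ w ≤ 2) (hL : ∃ w ∈ L, deficiency δ w ≤ 2)
    (w : List (Fin 2)) : deficiency δ w ≤ 2 := by
  obtain ⟨e, he, ι, h⟩ := exists_models_glue hs ht
  refine PartialAutomaton.search_sound (List.all_eq_true.1 hverify e he) h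
    (List.forall_mem_map.2 fun v hv => ⟨∅, .nil, ?_⟩) (by rwa [regexL_matches']) w
  rw [← deficiency_eq_ncard_kernImage]
  exact hws v hv

/-- Words of length three and words of `W'`, found by computer, that settle the case of letters `a`
and `b` of the given shapes. Only one order of two shapes is listed, the other being its dual. -/
def testWords : Shape → Shape → Option (List (List (Fin 2)))
  | .bijective, .bijective => some []
  | .bijective, .triple => some [[a, b, a, b, b, a, b, a], [b, a, a, b, a, b, a, a, b]]
  | .bijective, .twoPairs => some
      [[a, b, b, a, b, b, a], [b, a, a, b, a, b, a, a, b], [b, b, a, a, a, b]]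
  | .bijective, .innerPair => some
      [[b, a, a, b, a, a, b], [a, b, b, a, b, a, b, b, a], [b, a, a, b, a, b, a, a, b],
       [b, a, a, b, b, a, a, b], [a, b, a, b, b, a, b, a], [b, a, b, a, a, a, b],
       [b, a, a, a, b, a, b], [b, a, a, a, b, a, a, a, b], [b, a, b, a, a, b, a, b]]
  | .bijective, .outerPair => some
      [[a, b, b, b, a, b, b, b, a], [a, b, b, a, b, a, b, b, a], [a, b, b, a, a, b, b, a],
       [b, a, a, b, a, b, a, a, b]]
  | .triple, .triple => some [[b, a, b]]
  | .triple, .twoPairs => some [[b, a, b]]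
  | .triple, .innerPair => some [[b, a, a, a, b, a, b], [a, b, b, a, b, a, b, b, a]]
  | .triple, .outerPair => some [[a, b, a, b, b, b, a], [b, a, a]]
  | .twoPairs, .twoPairs => some [[b, a, a, a, b, a, a, a, b]]
  | .twoPairs, .innerPair => some
      [[b, a, a, a, b, a, a, a, b], [a, b, b, a, b, a, b, b, a], [a, b, b, b, a, b, a]]
  | .twoPairs, .outerPair => some [[a, b, b, b, a, b, b, b, a], [b, a, b, a, a, a, b]]
  | .innerPair, .innerPair => some
      [[b, a, a, b, a, b, a, a, b], [b, a, b], [a, b, b, a, b, b, a], [a, b, b, a, a, b, b, a]]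
  | .innerPair, .outerPair => some
      [[a, b, b, b, a, b, b, b, a], [a, b, b, a, b, a, b, b, a], [a, b, a],
       [a, b, b, a, a, b, b, a]]
  | .outerPair, .outerPair => some
      [[b, a, a, b, b, a, a, b], [b, a, a, a, b, a, a, a, b], [a, b, b, b, a, b, b, b, a],
       [b, a, b]]
  | _, _ => none

theorem isSome_testWords_or (s t : Shape) :
    (testWords s t).isSome ∨ (testWords t s).isSome := by
  cases s <;> cases t <;> decide

theorem length_eq_three_or_mem_W'_of_mem_testWords {s t : Shape} {ws : List (List (Fin 2))}
    (h : testWords s t = some ws) : ∀ w ∈ ws, w.length = 3 ∨ w ∈ W' := by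
  have hall : ∀ ws ∈ testWords s t, ∀ w ∈ ws, w.length = 3 ∨ w ∈ W' := by
    cases s <;> cases t <;> decide
  exact hall ws h

set_option maxHeartbeats 1000000 in
-- Fifteen kernel computations share the heartbeats of this declaration.
theorem verify_testWords {s t : Shape} {ws : List (List (Fin 2))}
    (h : testWords s t = some ws) : s.verify t ws := by
  have hall : ∀ ws ∈ testWords s t, s.verify t ws := by
    cases s <;> cases t <;> decide +kernel
  exact hall ws h

end Certificates

section Tests

variable {Q : Type} {δ : Q → Fin 2 → Q}

/-- The deficiency is at most two on the words of length three, the words of `W'`, some word of `𝓛`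
and some word of the dual language. -/
structure SmallOnTests (δ : Q → Fin 2 → Q) : Prop where
  of_length_eq_three : ∀ w : List (Fin 2), w.length = 3 → deficiency δ w ≤ 2
  of_mem_W' : ∀ w ∈ W', deficiency δ w ≤ 2
  exists_mem_L : ∃ w ∈ L, deficiency δ w ≤ 2
  exists_mem_dualL : ∃ w ∈ dualL, deficiency δ w ≤ 2

theorem dual_dual (w : List (Fin 2)) : dual (dual w) = w := by
  simp [dual, Function.comp_def]

theorem mem_dualL_iff {w : List (Fin 2)} : w ∈ dualL ↔ dual w ∈ L :=
  Iff.rfl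

theorem dual_mem_W' : ∀ w ∈ W', dual w ∈ W' := by
  decide

theorem deficiency_swap (δ : Q → Fin 2 → Q) (w : List (Fin 2)) :
    deficiency (fun q x => δ q (Equiv.swap a b x)) w = deficiency δ (dual w) := by
  have hact : act (fun q x => δ q (Equiv.swap a b x)) w = act δ (dual w) := by
    ext q
    simp [act, dual, List.foldl_map]
  rw [deficiency, deficiency, hact]

namespace SmallOnTests

theorem swap (h : SmallOnTests δ) : SmallOnTests fun q x => δ q (Equiv.swap a b x) where
  of_length_eq_three w hw := by
    rw [deficiency_swap]
    exact h.of_length_eq_three _ (by rwa [dual, List.length_map])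
  of_mem_W' w hw := by
    rw [deficiency_swap]
    exact h.of_mem_W' _ (dual_mem_W' w hw)
  exists_mem_L := by
    obtain ⟨v, hv, hle⟩ := h.exists_mem_dualL
    exact ⟨dual v, hv, by rwa [deficiency_swap, dual_dual]⟩
  exists_mem_dualL := by
    obtain ⟨u, hu, hle⟩ := h.exists_mem_L
    exact ⟨dual u, mem_dualL_iff.2 (by rwa [dual_dual]), by rwa [deficiency_swap, dual_dual]⟩

variable [Finite Q]

theorem deficiency_le_of_testWords (h : SmallOnTests δ) {s t : Shape}
    (hst : (testWords s t).isSome) (hs : s.Fits (δ · a)) (ht : t.Fits (δ · b))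
    (w : List (Fin 2)) : deficiency δ w ≤ 2 := by
  obtain ⟨ws, hws⟩ := Option.isSome_iff_exists.1 hst
  refine Shape.deficiency_le_of_verify (verify_testWords hws) hs ht (fun v hv => ?_)
    h.exists_mem_L w
  exact (length_eq_three_or_mem_W'_of_mem_testWords hws v hv).elim
    (h.of_length_eq_three v) (h.of_mem_W' v)

theorem exists_shape [Nonempty Q] (h : SmallOnTests δ) (x : Fin 2) :
    ∃ s : Shape, s.Fits (δ · x) := by
  have hle : deficiency δ [x, x] ≤ 2 :=
    (deficiency_le_of_isInfix δ ⟨[], [x], rfl⟩).trans (h.of_length_eq_three [x, x, x] rfl)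
  rw [deficiency_eq_ncard_kernImage] at hle
  simp only [kernImage_act_cons, kernImage_act_nil] at hle
  exact Shape.exists_fits hle

theorem deficiency_le (h : SmallOnTests δ) (w : List (Fin 2)) : deficiency δ w ≤ 2 := by
  rcases isEmpty_or_nonempty Q with hQ | hQ
  · simp [deficiency]
  obtain ⟨s, hs⟩ := h.exists_shape a
  obtain ⟨t, ht⟩ := h.exists_shape b
  rcases isSome_testWords_or s t with hst | hts
  · exact h.deficiency_le_of_testWords hst hs ht w
  · have hswap := h.swap.deficiency_le_of_testWords hts (by simpa using ht) (by simpa using hs)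
      (dual w)
    rwa [deficiency_swap, dual_dual] at hswap

end SmallOnTests

end Tests

theorem isCollapsing_of_forall_mem_W' {u v w : List (Fin 2)} (hu : u ∈ L) (hv : v ∈ dualL)
    (hfull : IsFull 3 w) (hW' : ∀ x ∈ W', x <:+: w) (huw : u <:+: w) (hvw : v <:+: w) :
    IsCollapsing 3 w := by
  have hne : w ≠ [] := by
    rintro rfl
    simpa using hfull [a, a, a] rfl
  refine ⟨hne, fun Q _ δ ⟨x, _, hx⟩ => ⟨hne, ?_⟩⟩
  by_contra! hlt
  have hle : ∀ y, y <:+: w → deficiency δ y ≤ 2 := fun y hy =>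
    (deficiency_le_of_isInfix δ hy).trans (Nat.le_of_lt_succ hlt)
  have hsmall : SmallOnTests δ :=
    ⟨fun y hy => hle y (hfull y hy), fun y hy => hle y (hW' y hy), ⟨u, hu, hle u huw⟩,
      ⟨v, hv, hle v hvw⟩⟩
  exact (hx.trans (hsmall.deficiency_le x)).not_gt (by norm_num)

theorem isCollapsing_of_forall_mem_W {w : List (Fin 2)} (hfull : IsFull 3 w)
    (hW : ∀ x ∈ W, x <:+: w) : IsCollapsing 3 w :=
  isCollapsing_of_forall_mem_W' (u := [b, b, a, a, a, b, b]) (v := [a, a, b, b, b, a, a])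
    (mem_L_of_rmatch (by decide)) (mem_L_of_rmatch (by decide)) hfull
    (fun x hx => hW x (Finset.mem_sdiff.1 hx).1) (hW _ (by decide)) (hW _ (by decide))

theorem isFull_w₃ : IsFull 3 w₃ := by
  intro x hx
  obtain ⟨p, q, r, rfl⟩ := List.length_eq_three.1 hx
  revert p q r
  decide

end CollapsingWords

theorem mainTheorem1 :
    (∀ w : List (Fin 2), CollapsingWords.IsFull 3 w →
      (∀ x ∈ CollapsingWords.W, x <:+: w) → CollapsingWords.IsCollapsing 3 w) ∧
    (∀ u ∈ CollapsingWords.L, ∀ v ∈ CollapsingWords.dualL,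
      ∀ w : List (Fin 2), CollapsingWords.IsFull 3 w →
        (∀ x ∈ CollapsingWords.W', x <:+: w) → u <:+: w → v <:+: w →
          CollapsingWords.IsCollapsing 3 w) ∧
    (CollapsingWords.w₃.length = 53 ∧
      CollapsingWords.IsFull 3 CollapsingWords.w₃ ∧
      (∀ x ∈ CollapsingWords.W', x <:+: CollapsingWords.w₃) ∧
      CollapsingWords.u ∈ CollapsingWords.L ∧ CollapsingWords.u <:+: CollapsingWords.w₃ ∧
      CollapsingWords.v ∈ CollapsingWords.dualL ∧ CollapsingWords.v <:+: CollapsingWords.w₃ ∧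
      CollapsingWords.IsCollapsing 3 CollapsingWords.w₃) ∧
    CollapsingWords.c 3 2 ≤ 53 := by
  have hW' : ∀ x ∈ CollapsingWords.W', x <:+: CollapsingWords.w₃ := by decide
  have hu : CollapsingWords.u ∈ CollapsingWords.L := CollapsingWords.mem_L_of_rmatch (by decide)
  have hv : CollapsingWords.v ∈ CollapsingWords.dualL :=
    CollapsingWords.mem_dualL_iff.2 (CollapsingWords.mem_L_of_rmatch (by decide))
  have huw : CollapsingWords.u <:+: CollapsingWords.w₃ := by decide
  have hvw : CollapsingWords.v <:+: CollapsingWords.w₃ := by decide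
  have hcol : CollapsingWords.IsCollapsing 3 CollapsingWords.w₃ :=
    CollapsingWords.isCollapsing_of_forall_mem_W' hu hv CollapsingWords.isFull_w₃ hW' huw hvw
  exact ⟨fun _ => CollapsingWords.isCollapsing_of_forall_mem_W,
    fun _ hu _ hv _ => CollapsingWords.isCollapsing_of_forall_mem_W' hu hv,
    ⟨rfl, CollapsingWords.isFull_w₃, hW', hu, huw, hv, hvw, hcol⟩,
    iInf₂_le CollapsingWords.w₃ hcol⟩
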